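/- Let $R$ be the countable universal homogeneous graph (also called the random graph or the Rado graph), that is, the countable Fraïssé limit of the class of finite simple undirected graphs, and let $M = \operatorname{End} R$ be the monoid of all graph endomorphisms of $R$, i.e. of all maps from the vertex set of $R$ to itself that send edges to edges. Green's relations on $M$ are defined by: $f \mathrel{\mathscr{L}} g$ if and only if $Mf = Mg$; $f \mathrel{\mathscr{R}} g$ if and only if $fM = gM$; and $\mathscr{D} = \mathscr{L} \circ \mathscr{R}$ (an equivalence relation). A $\mathscr{D}$-class is called regular if it contains an element $f$ that is regular, i.e. such that $fgf = f$ for some $g \in M$ (equivalently, if all of its elements are regular). Theorem. Every regular $\mathscr{D}$-class of $\operatorname{End} R$ contains exactly $2^{\aleph_0}$ many $\mathscr{L}$-classes and exactly $2^{\aleph_0}$ many $\mathscr{R}$-classes. -/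

import Mathlib

open FirstOrder

universe u

/-! ### Green's relations on a monoid -/

section Green

variable {M : Type u} [Monoid M]

/-- Green's relation L: `a` and `b` generate the same left ideal, `M a = M b`. -/
def GreenL (a b : M) : Prop :=
  Set.range (fun m : M => m * a) = Set.range (fun m : M => m * b)

/-- Green's relation R: `a` and `b` generate the same right ideal, `a M = b M`. -/
def GreenR (a b : M) : Prop :=
  Set.range (fun m : M => a * m) = Set.range (fun m : M => b * m)

/-- Green's relation D: the composite of L and R. -/
def GreenD (a b : M) : Prop :=
  ∃ c : M, GreenL a c ∧ GreenR c b

/-- `X` is an equivalence class of Green's relation L. -/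
def IsLClass (X : Set M) : Prop := ∃ a : M, X = {b | GreenL a b}

/-- `X` is an equivalence class of Green's relation R. -/
def IsRClass (X : Set M) : Prop := ∃ a : M, X = {b | GreenR a b}

/-- `X` is an equivalence class of Green's relation D. -/
def IsDClass (X : Set M) : Prop := ∃ a : M, X = {b | GreenD a b}

/-- An element `a` of a monoid is regular (in the sense of semigroup theory) if `a g a = a` for
some `g`. -/
def IsSemigroupRegular (a : M) : Prop := ∃ g : M, a * g * a = a

/-- A regular D-class is a D-class that contains a regular element
(equivalently, a D-class all of whose elements are regular). -/
def IsRegularDClass (X : Set M) : Prop :=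
  IsDClass X ∧ ∃ a ∈ X, IsSemigroupRegular a

end Green

/-! ### The countable universal graph -/

/-- The class of finite (simple, undirected) graphs, as structures in the language of graphs. -/
def finiteGraphs : Set (CategoryTheory.Bundled.{u} Language.graph.Structure) :=
  {H | Finite H ∧ H ⊨ Language.Theory.simpleGraph}

/-- A graph on a countable vertex set is (a copy of) the countable universal homogeneous graph if
it is a Fraïssé limit of the class of finite graphs: the finite graphs are exactly the finite
structures that embed in it, and every embedding of a finite induced subgraph extends to an
automorphism. -/
def IsCountableUniversalGraph {V : Type u} [Countable V] (R : SimpleGraph V) : Prop :=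
  letI : Language.graph.Structure V := R.structure
  Language.IsFraisseLimit finiteGraphs V

/-! ### Green's relations as mutual divisibility -/

section GreenLemmas

variable {M : Type u} [Monoid M]

/-! A regular endomorphism splits as `i ∘ p` through its image graph `H`, with `i` a section and `p`
a retraction. So `H` is a retract of `R` and inherits common neighbours for finite sets. Conversely,
over any countable `H` with that property, a tower of new vertices realises every finite
neighbourhood infinitely often. By uniqueness of Fraïssé limits it is a copy of `R`, and it retracts
to `H` by recursion with two choices at each vertex (`exists_retractions`). The resulting maps `i ∘
r t` give continuum many L-classes. For R-classes, the graph `H × Bool` with each vertex doubled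
also embeds as a retract; its sections `x ↦ (x, t x)` over the infinite graph `H` give continuum
many maps with different images. Both families stay in `D`, and `End R` has at most continuum many
elements. -/

theorem greenL_iff {a b : M} : GreenL a b ↔ (∃ x, a = x * b) ∧ ∃ y, b = y * a := by
  constructor
  · intro h
    have ha : a ∈ Set.range (fun m : M => m * a) := ⟨1, one_mul a⟩
    have hb : b ∈ Set.range (fun m : M => m * b) := ⟨1, one_mul b⟩
    rw [h] at ha
    rw [← h] at hb
    obtain ⟨x, hx⟩ := ha
    obtain ⟨y, hy⟩ := hb
    exact ⟨⟨x, hx.symm⟩, ⟨y, hy.symm⟩⟩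
  · rintro ⟨⟨x, hx⟩, ⟨y, hy⟩⟩
    apply Set.Subset.antisymm
    · rintro _ ⟨m, rfl⟩
      exact ⟨m * x, by simp only [mul_assoc, ← hx]⟩
    · rintro _ ⟨m, rfl⟩
      exact ⟨m * y, by simp only [mul_assoc, ← hy]⟩

theorem greenR_iff {a b : M} : GreenR a b ↔ (∃ x, a = b * x) ∧ ∃ y, b = a * y := by
  constructor
  · intro h
    have ha : a ∈ Set.range (fun m : M => a * m) := ⟨1, mul_one a⟩
    have hb : b ∈ Set.range (fun m : M => b * m) := ⟨1, mul_one b⟩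
    rw [h] at ha
    rw [← h] at hb
    obtain ⟨x, hx⟩ := ha
    obtain ⟨y, hy⟩ := hb
    exact ⟨⟨x, hx.symm⟩, ⟨y, hy.symm⟩⟩
  · rintro ⟨⟨x, hx⟩, ⟨y, hy⟩⟩
    apply Set.Subset.antisymm
    · rintro _ ⟨m, rfl⟩
      exact ⟨x * m, by simp only [← mul_assoc, ← hx]⟩
    · rintro _ ⟨m, rfl⟩
      exact ⟨y * m, by simp only [← mul_assoc, ← hy]⟩

theorem GreenL.refl (a : M) : GreenL a a := Eq.refl _

theorem GreenR.refl (a : M) : GreenR a a := Eq.refl _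

theorem GreenL.symm {a b : M} (h : GreenL a b) : GreenL b a := Eq.symm h

theorem GreenR.symm {a b : M} (h : GreenR a b) : GreenR b a := Eq.symm h

theorem GreenL.trans {a b c : M} (h : GreenL a b) (h' : GreenL b c) : GreenL a c := Eq.trans h h'

theorem GreenR.trans {a b c : M} (h : GreenR a b) (h' : GreenR b c) : GreenR a c := Eq.trans h h'

/-- Green's relations L and R commute. -/
theorem GreenD.exists_greenR_greenL {a b : M} (h : GreenD a b) :
    ∃ d, GreenR a d ∧ GreenL d b := by
  obtain ⟨c, hac, hcb⟩ := h
  obtain ⟨⟨x, hx⟩, ⟨y, hy⟩⟩ := greenL_iff.1 hac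
  obtain ⟨⟨w, hw⟩, ⟨v, hv⟩⟩ := greenR_iff.1 hcb
  refine ⟨a * v, greenR_iff.2 ⟨⟨w, ?_⟩, ⟨v, rfl⟩⟩, greenL_iff.2 ⟨⟨x, ?_⟩, ⟨y, ?_⟩⟩⟩
  · calc a = x * (b * w) := by rw [← hw, ← hx]
      _ = a * v * w := by rw [hv, hx]; simp only [mul_assoc]
  · rw [hv, ← mul_assoc, ← hx]
  · rw [← mul_assoc, ← hy, hv]

theorem GreenD.trans {a b c : M} (h : GreenD a b) (h' : GreenD b c) : GreenD a c := by
  obtain ⟨d, h1, h2⟩ := h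
  obtain ⟨e, h3, h4⟩ := h'
  obtain ⟨k, h5, h6⟩ := GreenD.exists_greenR_greenL ⟨b, h3.symm, h2.symm⟩
  exact ⟨k, h1.trans h6.symm, h5.symm.trans h4⟩

end GreenLemmas

/-! ### One-point extensions of finite partial embeddings -/

section ExtensionProperty

variable {W : Type*}

/-- For all disjoint finite sets `A` and `B` of vertices there is a further vertex that is joined to
all vertices in `A` and to none in `B`. -/
def HasExtensionProperty (G : SimpleGraph W) : Prop :=
  ∀ A B : Finset W, Disjoint A B →
    ∃ v, v ∉ A ∧ v ∉ B ∧ (∀ a ∈ A, G.Adj v a) ∧ ∀ b ∈ B, ¬ G.Adj v b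

/-- `f` restricts to an isomorphism from the subgraph induced on `S` to an induced subgraph. -/
def IsEmbeddingOn {X : Type*} (H : SimpleGraph X) (G : SimpleGraph W) (f : X → W) (S : Set X) :
    Prop :=
  Set.InjOn f S ∧ ∀ a ∈ S, ∀ b ∈ S, G.Adj (f a) (f b) ↔ H.Adj a b

theorem HasExtensionProperty.exists_extend {G : SimpleGraph W} (hG : HasExtensionProperty G)
    {X : Type*} {H : SimpleGraph X} {f : X → W} {S : Set X} (hS : S.Finite)
    (hf : IsEmbeddingOn H G f S) (m : X) :
    ∃ f' : X → W, Set.EqOn f' f S ∧ IsEmbeddingOn H G f' (insert m S) := by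
  classical
  by_cases hm : m ∈ S
  · exact ⟨f, fun _ _ => rfl, by rwa [Set.insert_eq_of_mem hm]⟩
  lift S to Finset X using hS
  have hm' : m ∉ S := hm
  obtain ⟨v, hvA, hvB, hA, hB⟩ := hG ((S.filter (H.Adj m)).image f)
    ((S.filter (fun x => ¬ H.Adj m x)).image f) (by
      rw [Finset.disjoint_left]
      intro w hw hw'
      simp only [Finset.mem_image, Finset.mem_filter] at hw hw'
      obtain ⟨x, ⟨hx, hmx⟩, rfl⟩ := hw
      obtain ⟨y, ⟨hy, hmy⟩, hxy⟩ := hw'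
      exact hmy (hf.1 hy hx hxy ▸ hmx))
  have hne : ∀ x ∈ S, x ≠ m := fun x hx h => hm' (h ▸ hx)
  have hv : ∀ x ∈ S, f x ≠ v := by
    intro x hx h
    by_cases hmx : H.Adj m x
    · exact hvA (Finset.mem_image.2 ⟨x, Finset.mem_filter.2 ⟨hx, hmx⟩, h⟩)
    · exact hvB (Finset.mem_image.2 ⟨x, Finset.mem_filter.2 ⟨hx, hmx⟩, h⟩)
  have hadj : ∀ x ∈ S, G.Adj v (f x) ↔ H.Adj m x := by
    intro x hx
    by_cases hmx : H.Adj m x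
    · exact iff_of_true
        (hA _ (Finset.mem_image.2 ⟨x, Finset.mem_filter.2 ⟨hx, hmx⟩, rfl⟩)) hmx
    · exact iff_of_false
        (hB _ (Finset.mem_image.2 ⟨x, Finset.mem_filter.2 ⟨hx, hmx⟩, rfl⟩)) hmx
  have hup : ∀ x ∈ S, Function.update f m v x = f x := fun x hx =>
    Function.update_of_ne (hne x hx) _ _
  refine ⟨Function.update f m v, hup, ?_, ?_⟩
  · rintro a (rfl | ha) b (rfl | hb) hab
    · rfl
    · rw [hup b hb, Function.update_self] at hab
      exact absurd hab.symm (hv b hb)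
    · rw [hup a ha, Function.update_self] at hab
      exact absurd hab (hv a ha)
    · rw [hup a ha, hup b hb] at hab
      exact hf.1 ha hb hab
  · rintro a (rfl | ha) b (rfl | hb)
    · simp
    · rw [hup b hb, Function.update_self, hadj b hb]
    · rw [hup a ha, Function.update_self, G.adj_comm, H.adj_comm, hadj a ha]
    · rw [hup a ha, hup b hb, hf.2 a ha b hb]

theorem HasExtensionProperty.exists_embedding {G : SimpleGraph W} (hG : HasExtensionProperty G)
    {X : Type*} [Finite X] (H : SimpleGraph X) : Nonempty (H ↪g G) := by
  obtain ⟨w, -⟩ := hG ∅ ∅ (Finset.disjoint_empty_left _)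
  have key : ∀ S : Set X, S.Finite → ∃ f, IsEmbeddingOn H G f S := by
    intro S hS
    induction S, hS using Set.Finite.induction_on with
    | empty => exact ⟨fun _ => w, Set.injOn_empty _, fun a ha => ha.elim⟩
    | insert _ hS ih =>
      obtain ⟨f, hf⟩ := ih
      obtain ⟨f', -, hf'⟩ := hG.exists_extend hS hf _
      exact ⟨f', hf'⟩
  obtain ⟨f, hf⟩ := key Set.univ Set.finite_univ
  exact ⟨⟨⟨f, Set.injOn_univ.1 hf.1⟩, hf.2 _ trivial _ trivial⟩⟩

end ExtensionProperty

/-! ### The extension property characterises the Fraïssé limit -/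

section FraisseLimit

/-- Graph embeddings are embeddings of structures. -/
def SimpleGraph.Embedding.toStructureEmbedding {X W : Type*} {H : SimpleGraph X}
    {G : SimpleGraph W} (f : H ↪g G) :
    letI := H.structure
    letI := G.structure
    X ↪[Language.graph] W :=
  letI := H.structure
  letI := G.structure
  { toEmbedding := f.toEmbedding
    map_fun' := fun g => isEmptyElim g
    map_rel' := fun {n} r x => by
      match n, r with
      | 2, .adj => exact f.map_rel_iff }

theorem structureEmbedding_adj_iff {X W : Type*} (H : SimpleGraph X) (G : SimpleGraph W)
    (f : letI := H.structure; letI := G.structure; X ↪[Language.graph] W) (a b : X) :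
    G.Adj (letI := H.structure; letI := G.structure; f a)
      (letI := H.structure; letI := G.structure; f b) ↔ H.Adj a b := by
  let := H.structure
  let := G.structure
  exact f.map_rel Language.adj ![a, b]

theorem model_simpleGraph_of_embedding {X W : Type*} [Language.graph.Structure X]
    (G : SimpleGraph W) (f : letI := G.structure; X ↪[Language.graph] W) :
    X ⊨ Language.Theory.simpleGraph := by
  let := G.structure
  rw [Language.Theory.simpleGraph_model_iff]
  have key : ∀ a b : X, Language.Structure.RelMap Language.adj ![a, b] ↔ G.Adj (f a) (f b) :=
    fun a b => (f.map_rel Language.adj ![a, b]).symm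
  exact ⟨⟨fun a h => G.irrefl ((key a a).1 h)⟩, ⟨fun a b h => (key b a).2 ((key a b).1 h).symm⟩⟩

theorem HasExtensionProperty.isExtensionPair {X W : Type*} (H : SimpleGraph X)
    {G : SimpleGraph W} (hG : HasExtensionProperty G) :
    letI := H.structure
    letI := G.structure
    Language.graph.IsExtensionPair X W := by
  let := H.structure
  let := G.structure
  rw [Language.isExtensionPair_iff_exists_embedding_closure_singleton_sup]
  intro S hS f m
  have := hS.finite
  obtain ⟨w, -⟩ := hG ∅ ∅ (Finset.disjoint_empty_left _)
  have hf : ∀ x : S, Function.extend Subtype.val f (fun _ => w) x.1 = f x := fun x =>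
    Subtype.val_injective.extend_apply _ _ x
  have hemb : IsEmbeddingOn H G (Function.extend Subtype.val f fun _ => w) S := by
    refine ⟨fun a ha b hb hab => ?_, fun a ha b hb => ?_⟩
    · rw [hf ⟨a, ha⟩, hf ⟨b, hb⟩] at hab
      exact congrArg Subtype.val (f.injective hab)
    · rw [hf ⟨a, ha⟩, hf ⟨b, hb⟩]
      exact f.map_rel Language.adj ![⟨a, ha⟩, ⟨b, hb⟩]
  obtain ⟨f', hf', hinj, hadj⟩ := hG.exists_extend (Set.toFinite _ : (S : Set X).Finite) hemb m
  have hle : ∀ x ∈ Language.Substructure.closure Language.graph {m} ⊔ S,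
      x ∈ insert m (S : Set X) := by
    -- The language has no function symbols, so every subset is a substructure.
    let T : Language.graph.Substructure X := ⟨insert m (S : Set X), fun g => isEmptyElim g⟩
    have hST : Language.Substructure.closure Language.graph {m} ⊔ S ≤ T :=
      sup_le (Language.Substructure.closure_le.2
        (Set.singleton_subset_iff.2 (Set.mem_insert _ _))) (Set.subset_insert _ _)
    exact fun x hx => hST hx
  refine ⟨⟨⟨fun x => f' x.1, fun x y hxy =>
    Subtype.ext (hinj (hle _ x.2) (hle _ y.2) hxy)⟩, fun g => isEmptyElim g, ?_⟩, ?_⟩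
  · intro n r x
    match n, r with
    | 2, .adj => exact hadj _ (hle _ (x 0).2) _ (hle _ (x 1).2)
  · ext x
    exact (hf x).symm.trans (hf' x.2).symm

theorem HasExtensionProperty.isCountableUniversalGraph {W : Type u} [Countable W]
    {G : SimpleGraph W} (hG : HasExtensionProperty G) : IsCountableUniversalGraph G := by
  let := G.structure
  refine ⟨?_, ?_⟩
  · rw [Language.isUltrahomogeneous_iff_IsExtensionPair Language.Structure.cg_of_countable]
    exact hG.isExtensionPair G
  · ext N
    constructor
    · rintro ⟨hN, ⟨f⟩⟩
      exact ⟨hN.finite, model_simpleGraph_of_embedding G f⟩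
    · rintro ⟨hN, hN'⟩
      refine ⟨Language.Structure.fg_iff_finite.2 hN, ?_⟩
      obtain ⟨f⟩ := hG.exists_embedding (Language.simpleGraphOfStructure N)
      have := f.toStructureEmbedding
      rw [Language.structure_simpleGraphOfStructure] at this
      exact ⟨this⟩

theorem IsCountableUniversalGraph.nonempty_iso {V W : Type u} [Countable V] [Countable W]
    {R : SimpleGraph V} {G : SimpleGraph W} (hR : IsCountableUniversalGraph R)
    (hG : IsCountableUniversalGraph G) : Nonempty (R ≃g G) := by
  let := R.structure
  let := G.structure
  obtain ⟨e⟩ := Language.IsFraisseLimit.nonempty_equiv hR hG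
  exact ⟨⟨e.toEquiv, fun {a b} => structureEmbedding_adj_iff R G e.toEmbedding a b⟩⟩

end FraisseLimit

/-! ### Common neighbours and retracts -/

section AlgebraicallyClosed

/-- Every finite set of vertices has a common neighbour. -/
def SimpleGraph.IsAlgebraicallyClosed {X : Type*} (H : SimpleGraph X) : Prop :=
  ∀ A : Finset X, ∃ v, ∀ a ∈ A, H.Adj v a

variable {X : Type*} {H : SimpleGraph X}

theorem SimpleGraph.IsAlgebraicallyClosed.infinite (hH : H.IsAlgebraicallyClosed) :
    Infinite X := by
  by_contra h
  rw [not_infinite_iff_finite] at h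
  have := Fintype.ofFinite X
  obtain ⟨v, hv⟩ := hH Finset.univ
  exact H.irrefl (hv v (Finset.mem_univ v))

theorem SimpleGraph.IsAlgebraicallyClosed.exists_injective (hH : H.IsAlgebraicallyClosed)
    (A : Finset X) :
    ∃ nbr : Bool → X, Function.Injective nbr ∧ ∀ b, ∀ a ∈ A, H.Adj (nbr b) a := by
  classical
  obtain ⟨v, hv⟩ := hH A
  -- Adjacency of `w` to `v` forces `w ≠ v`.
  obtain ⟨w, hw⟩ := hH (insert v A)
  have hwv : H.Adj w v := hw v (Finset.mem_insert_self v A)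
  refine ⟨fun b => cond b v w, ?_, ?_⟩
  · rintro (_ | _) (_ | _) h
    · rfl
    · exact absurd h hwv.ne
    · exact absurd h hwv.ne'
    · rfl
  · rintro (_ | _) a ha
    · exact hw a (Finset.mem_insert_of_mem ha)
    · exact hv a ha

theorem SimpleGraph.IsAlgebraicallyClosed.of_retract {W : Type*} {G : SimpleGraph W}
    (hG : G.IsAlgebraicallyClosed) (i : H →g G) (q : G →g H) (hq : ∀ x, q (i x) = x) :
    H.IsAlgebraicallyClosed := by
  classical
  intro A
  obtain ⟨v, hv⟩ := hG (A.image i)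
  refine ⟨q v, fun a ha => ?_⟩
  have := q.map_adj (hv (i a) (Finset.mem_image_of_mem i ha))
  rwa [hq] at this

theorem SimpleGraph.IsAlgebraicallyClosed.comap_fst (hH : H.IsAlgebraicallyClosed)
    (Y : Type*) [Nonempty Y] :
    (H.comap (Prod.fst : X × Y → X)).IsAlgebraicallyClosed := by
  classical
  intro A
  obtain ⟨v, hv⟩ := hH (A.image Prod.fst)
  exact ⟨(v, Classical.arbitrary Y), fun a ha => hv a.1 (Finset.mem_image_of_mem _ ha)⟩

theorem HasExtensionProperty.isAlgebraicallyClosed {G : SimpleGraph X}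
    (hG : HasExtensionProperty G) : G.IsAlgebraicallyClosed := by
  intro A
  obtain ⟨v, -, -, hv, -⟩ := hG A ∅ (Finset.disjoint_empty_right A)
  exact ⟨v, hv⟩

end AlgebraicallyClosed

/-! ### Towers over a graph and their retractions -/

section Tower

theorem exists_infinitely_repeating_seq (Y : Type*) [Countable Y] [Nonempty Y] :
    ∃ c : ℕ → Y, ∀ y N, ∃ n, N ≤ n ∧ c n = y := by
  obtain ⟨g, hg⟩ := exists_surjective_nat Y
  refine ⟨fun n => g n.unpair.1, fun y N => ?_⟩
  obtain ⟨k, rfl⟩ := hg y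
  exact ⟨Nat.pair k N, Nat.right_le_pair k N, by simp⟩

variable {X : Type*} (H : SimpleGraph X) (code : ℕ → Finset (X ⊕ ℕ))

/-- The vertex `n` is joined to the vertex `w` of the base graph or to the smaller vertex `w`, as
prescribed by `code n`. -/
def TowerRel (n : ℕ) : X ⊕ ℕ → Prop
  | .inl a => .inl a ∈ code n
  | .inr m => m < n ∧ .inr m ∈ code n

/-- The graph obtained from `H` by successively adding vertices `0, 1, 2, …`, where `n` is joined to
those earlier vertices that lie in `code n`. -/
def towerGraph : SimpleGraph (X ⊕ ℕ) where
  Adj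
  | .inl a, .inl b => H.Adj a b
  | .inl a, .inr n => TowerRel code n (.inl a)
  | .inr n, .inl a => TowerRel code n (.inl a)
  | .inr n, .inr m => TowerRel code n (.inr m) ∨ TowerRel code m (.inr n)
  symm := ⟨by
    rintro (a | n) (b | m) h
    · exact SimpleGraph.Adj.symm h
    · exact h
    · exact h
    · exact Or.symm h⟩
  loopless := ⟨by
    rintro (a | n) h
    · exact H.irrefl h
    · rcases h with h | h
      · exact lt_irrefl _ h.1
      · exact lt_irrefl _ h.1⟩

theorem towerGraph_hasExtensionProperty (hcode : ∀ A N, ∃ n, N ≤ n ∧ code n = A) :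
    HasExtensionProperty (towerGraph H code) := by
  classical
  intro A B hAB
  obtain ⟨N, hN⟩ : ∃ N, ∀ m, Sum.inr m ∈ A ∪ B → m < N := by
    refine ⟨(A ∪ B).sup (Sum.elim (fun _ => 0) (fun m => m + 1)), fun m hm => ?_⟩
    exact Finset.le_sup (f := Sum.elim (fun _ => 0) (fun m => m + 1)) hm
  -- Since `n` exceeds every tower vertex in `A ∪ B`, its edges to them are decided by `code n`
  -- alone.
  obtain ⟨n, hn, hA⟩ := hcode A N
  have hlt : ∀ m, Sum.inr m ∈ A ∪ B → m < n := fun m hm => (hN m hm).trans_le hn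
  refine ⟨.inr n, fun h => lt_irrefl n (hlt n (Finset.mem_union_left _ h)),
    fun h => lt_irrefl n (hlt n (Finset.mem_union_right _ h)), ?_, ?_⟩
  · rintro (a | m) ha
    · change Sum.inl a ∈ code n
      exact hA ▸ ha
    · exact Or.inl ⟨hlt m (Finset.mem_union_left _ ha), hA ▸ ha⟩
  · rintro (b | m) hb h
    · exact Finset.disjoint_left.1 hAB (hA ▸ h) hb
    · rcases h with h | h
      · exact Finset.disjoint_left.1 hAB (hA ▸ h.2) hb
      · exact lt_asymm h.1 (hlt m (Finset.mem_union_right _ hb))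

open Classical in
/-- The images of the added vertices under the retraction of the tower to its base graph that sends
a vertex to a common neighbour of the images of the earlier vertices joined to it; `s` selects one
of two such neighbours. -/
noncomputable def towerRetract (nbr : Finset X → Bool → X) (s : ℕ → Bool) (n : ℕ) : X :=
  nbr ((code n).image fun w => match w with
    | .inl a => a
    -- The default only enlarges the set to be dominated; it serves termination.
    | .inr m => if m < n then towerRetract nbr s m else nbr ∅ false) (s n)
termination_by n

/-- Equal retractions present the same set to `nbr` at stage `n`, so the selected bits agree. -/
theorem towerRetract_injective {nbr : Finset X → Bool → X}
    (hnbr : ∀ A, Function.Injective (nbr A)) : Function.Injective (towerRetract code nbr) := by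
  intro s t hst
  funext n
  have h := congrFun hst n
  rw [towerRetract, towerRetract, hst] at h
  exact hnbr _ h

/-- The retraction of the tower to its base graph. -/
noncomputable def towerRetraction (nbr : Finset X → Bool → X)
    (hnbr : ∀ A b, ∀ a ∈ A, H.Adj (nbr A b) a) (s : ℕ → Bool) : towerGraph H code →g H where
  toFun := Sum.elim id (towerRetract code nbr s)
  map_rel' := by
    classical
    have key : ∀ n w, TowerRel code n w →
        H.Adj (towerRetract code nbr s n) (Sum.elim id (towerRetract code nbr s) w) := by
      rintro n (a | m) h
      · rw [towerRetract]
        exact hnbr _ _ _ (Finset.mem_image.2 ⟨.inl a, h, rfl⟩)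
      · rw [towerRetract]
        exact hnbr _ _ _ (Finset.mem_image.2 ⟨.inr m, h.2, by simp [h.1]⟩)
    rintro (a | n) (b | m) h
    · exact h
    · exact (key m (.inl a) h).symm
    · exact key n (.inl b) h
    · rcases h with h | h
      · exact key _ _ h
      · exact (key _ _ h).symm

end Tower

/-! ### Retractions of the universal graph -/

section Retractions

variable {V : Type u} [Countable V] {R : SimpleGraph V}

theorem IsCountableUniversalGraph.isAlgebraicallyClosed
    (hR : IsCountableUniversalGraph R) : R.IsAlgebraicallyClosed := by
  obtain ⟨c, hc⟩ := exists_infinitely_repeating_seq (Finset (PEmpty.{u + 1} ⊕ ℕ))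
  have hT := towerGraph_hasExtensionProperty (⊥ : SimpleGraph PEmpty.{u + 1}) c hc
  obtain ⟨e⟩ := hR.nonempty_iso hT.isCountableUniversalGraph
  exact hT.isAlgebraicallyClosed.of_retract e.toHom e.symm.toHom e.symm_apply_apply

/-- A countable algebraically closed graph is a retract of the countable universal graph in
continuum many ways. -/
theorem IsCountableUniversalGraph.exists_retractions (hR : IsCountableUniversalGraph R)
    {X : Type u} [Countable X] {H : SimpleGraph X} (hH : H.IsAlgebraicallyClosed) :
    ∃ (j : H →g R) (r : (ℕ → Bool) → (R →g H)),
      Function.Injective r ∧ ∀ s x, r s (j x) = x := by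
  choose nbr hinj hnbr using hH.exists_injective
  obtain ⟨c, hc⟩ := exists_infinitely_repeating_seq (Finset (X ⊕ ℕ))
  obtain ⟨e⟩ := hR.nonempty_iso
    (towerGraph_hasExtensionProperty H c hc).isCountableUniversalGraph
  let j : H →g towerGraph H c := ⟨Sum.inl, fun h => h⟩
  refine ⟨e.symm.toHom.comp j, fun s => (towerRetraction H c nbr hnbr s).comp e.toHom, ?_, ?_⟩
  · intro s t hst
    apply towerRetract_injective c hinj
    funext n
    have h := DFunLike.congr_fun hst (e.symm (.inr n))
    have h' : towerRetraction H c nbr hnbr s (e (e.symm (.inr n))) =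
      towerRetraction H c nbr hnbr t (e (e.symm (.inr n))) := h
    rw [e.apply_symm_apply] at h'
    exact h'
  · intro s x
    change towerRetraction H c nbr hnbr s (e (e.symm (.inl x))) = x
    rw [e.apply_symm_apply]
    rfl

end Retractions

/-! ### Split endomorphisms and counting classes -/

section RegularDClasses

variable {V : Type u} {R : SimpleGraph V} {X : Type*} {H : SimpleGraph X}

theorem greenL_comp {p : R →g H} {i i' : H →g R} {q q' : R →g H}
    (hq : ∀ x, q (i x) = x) (hq' : ∀ x, q' (i' x) = x) : GreenL (i.comp p) (i'.comp p) :=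
  greenL_iff.2 ⟨⟨i.comp q', RelHom.ext fun x => congrArg i (hq' (p x)).symm⟩,
    ⟨i'.comp q, RelHom.ext fun x => congrArg i' (hq (p x)).symm⟩⟩

theorem greenR_comp {p p' : R →g H} {i : H →g R} {s s' : H →g R}
    (hs : ∀ x, p (s x) = x) (hs' : ∀ x, p' (s' x) = x) : GreenR (i.comp p) (i.comp p') :=
  greenR_iff.2 ⟨⟨s'.comp p, RelHom.ext fun x => congrArg i (hs' (p x)).symm⟩,
    ⟨s.comp p', RelHom.ext fun x => congrArg i (hs (p' x)).symm⟩⟩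

theorem greenD_comp {p p' : R →g H} {i i' s s' : H →g R} {q q' : R →g H}
    (hq : ∀ x, q (i x) = x) (hq' : ∀ x, q' (i' x) = x)
    (hs : ∀ x, p (s x) = x) (hs' : ∀ x, p' (s' x) = x) : GreenD (i.comp p) (i'.comp p') :=
  ⟨i'.comp p, greenL_comp hq hq', greenR_comp hs hs'⟩

/-- A regular endomorphism splits through the subgraph induced on its range. -/
theorem IsSemigroupRegular.exists_splitting {a : R →g R} (ha : IsSemigroupRegular a) :
    ∃ (Y : Set V) (p q : R →g R.induce Y) (i s : R.induce Y →g R),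
      a = i.comp p ∧ (∀ x, q (i x) = x) ∧ ∀ x, p (s x) = x := by
  obtain ⟨g, hg⟩ := ha
  have hg' : ∀ x, a (g (a x)) = a x := fun x => DFunLike.congr_fun hg x
  let Y := Set.range a
  let p : R →g R.induce Y := ⟨fun x => ⟨a x, x, rfl⟩, fun h => a.map_adj h⟩
  let i : R.induce Y →g R := ⟨Subtype.val, fun h => h⟩
  refine ⟨Y, p, p.comp g, i, g.comp i, rfl, ?_, ?_⟩ <;>
  · rintro ⟨_, x, rfl⟩
    exact Subtype.ext (hg' x)

theorem mk_endomorphisms_le [Countable V] : Cardinal.mk (R →g R) ≤ Cardinal.continuum := by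
  have h : Function.Injective (fun f : R →g R => {x : V × V | f x.1 = x.2}) := by
    intro f g hfg
    ext x
    have : (x, f x) ∈ {x : V × V | f x.1 = x.2} := rfl
    rw [show {x : V × V | f x.1 = x.2} = {x : V × V | g x.1 = x.2} from hfg] at this
    exact this.symm
  refine (Cardinal.mk_le_of_injective h).trans ?_
  rw [Cardinal.mk_set, ← Cardinal.two_power_aleph0]
  exact Cardinal.power_le_power_left two_ne_zero Cardinal.mk_le_aleph0

/-- A set of classes `{b | r a b}` contained in `D` has the cardinality of the continuum if there is
a family of continuum many elements of `D` with distinct such classes contained in `D`. -/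
theorem mk_classes_eq_continuum {M : Type u} (hM : Cardinal.mk M ≤ Cardinal.continuum)
    (r : M → M → Prop) (hrefl : ∀ a, r a a) (D : Set M) {ι : Type*}
    (hι : Cardinal.mk ι = Cardinal.continuum) (f : ι → M)
    (hf : ∀ i b, r (f i) b → b ∈ D) (hinj : ∀ i j, r (f i) (f j) → i = j) :
    Cardinal.mk {Y : Set M // (∃ a, Y = {b | r a b}) ∧ Y ⊆ D} = Cardinal.continuum := by
  apply le_antisymm
  · refine le_trans (Cardinal.mk_le_of_injective (f := fun Y => Y.2.1.choose) ?_) hM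
    intro Y Z h
    apply Subtype.ext
    rw [Y.2.1.choose_spec, Z.2.1.choose_spec]
    exact congrArg (fun a => {b | r a b}) h
  · let F : ι → {Y : Set M // (∃ a, Y = {b | r a b}) ∧ Y ⊆ D} :=
      fun i => ⟨{b | r (f i) b}, ⟨f i, rfl⟩, hf i⟩
    have hF : Function.Injective F := by
      intro i j h
      have h' : f j ∈ {b | r (f j) b} := hrefl _
      rw [← show {b | r (f i) b} = {b | r (f j) b} from congrArg Subtype.val h] at h'
      exact hinj i j h'
    have := Cardinal.lift_mk_le_lift_mk_of_injective hF
    rw [hι] at this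
    simpa using this

end RegularDClasses

theorem mainTheorem5 {V : Type u} [Countable V] (R : SimpleGraph V)
    (hR : IsCountableUniversalGraph R)
    (D : Set (R →g R)) (hD : IsRegularDClass D) :
    Cardinal.mk {X : Set (R →g R) // IsLClass X ∧ X ⊆ D} = Cardinal.continuum ∧
      Cardinal.mk {X : Set (R →g R) // IsRClass X ∧ X ⊆ D} = Cardinal.continuum := by
  obtain ⟨⟨d, rfl⟩, a, hda, ha⟩ := hD
  obtain ⟨Y, p, q, i, s, rfl, hq, hs⟩ := ha.exists_splitting
  have hH : (R.induce Y).IsAlgebraicallyClosed := hR.isAlgebraicallyClosed.of_retract i q hq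
  have := hH.infinite
  constructor
  · obtain ⟨j, r, hr, hj⟩ := hR.exists_retractions hH
    refine mk_classes_eq_continuum mk_endomorphisms_le GreenL GreenL.refl _ (ι := ℕ → Bool)
      (by simp) (fun t => i.comp (r t)) ?_ ?_
    · intro t b hb
      exact GreenD.trans hda (GreenD.trans (greenD_comp hq hq hs (hj t)) ⟨b, hb, GreenR.refl b⟩)
    · intro t t' h
      obtain ⟨⟨m, hm⟩, -⟩ := greenL_iff.1 h
      have hm' : ∀ x, i (r t x) = m (i (r t' x)) := fun x => DFunLike.congr_fun hm x
      apply hr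
      ext1 x
      -- On the image of the common section `j` both retractions agree, so `m` fixes `i (r t' x)`.
      have h1 := hm' (j (r t' x))
      rw [hj, hj, ← hm'] at h1
      rw [← hq (r t x), ← h1, hq]
  · obtain ⟨j, r, -, hj⟩ := hR.exists_retractions (hH.comap_fst Bool)
    let k : (Y → Bool) → (R.induce Y →g (R.induce Y).comap (Prod.fst : Y × Bool → Y)) :=
      fun t => ⟨fun x => (x, t x), fun h => h⟩
    let l : (R.induce Y).comap (Prod.fst : Y × Bool → Y) →g R.induce Y := ⟨Prod.fst, fun h => h⟩
    let r₀ := r fun _ => false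
    have hr₀ : ∀ x, r₀ (j x) = x := hj _
    have hl : ∀ t x, (l.comp r₀) ((j.comp (k t)) x) = x := by
      intro t x
      change l (r₀ (j (k t x))) = x
      rw [hr₀]
      rfl
    refine mk_classes_eq_continuum mk_endomorphisms_le GreenR GreenR.refl _ (ι := Y → Bool)
      (by simp) (fun t => (j.comp (k t)).comp p) ?_ ?_
    · intro t b hb
      exact GreenD.trans hda (GreenD.trans (greenD_comp hq (hl t) hs hs) ⟨_, GreenL.refl _, hb⟩)
    · intro t t' h
      obtain ⟨⟨m, hm⟩, -⟩ := greenR_iff.1 h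
      funext y
      have h1 : j (k t (p (s y))) = j (k t' (p (m (s y)))) := DFunLike.congr_fun hm (s y)
      -- Applying `r₀` cancels `j`; the first coordinate then identifies the argument of `t'` as
      -- `y`.
      have h2 : (y, t y) = (p (m (s y)), t' (p (m (s y)))) := by
        have := congrArg r₀ h1
        rwa [hr₀, hr₀, hs] at this
      obtain ⟨h3, h4⟩ := Prod.ext_iff.1 h2
      exact h4.trans (congrArg t' h3.symm)
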